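/- Let $d$ be a prime power, $d=p^k$ with $p$ prime and $k\ge 1$, and let $\mathcal N$ be a quantum channel (a completely positive trace-preserving linear map) from $M_d(\mathbb C)$ to itself. A measurement assemblage is a finite family $\{E_{a|x}\}_{a,x}$ of positive semidefinite $d\times d$ matrices with $\sum_a E_{a|x}=\mathbb I$ for every $x$; it is jointly measurable if $E_{a|x}=\sum_\lambda P(a|x,\lambda)G_\lambda$ for some POVM $\{G_\lambda\}_\lambda$ with finitely many outcomes and some conditional probability distributions $P(a|x,\lambda)$. A channel $\mathcal L$ is incompatibility-annihilating, $\mathcal L\in\mathbf{IA}$, if for every measurement assemblage $\{E_{a|x}\}$ there is a jointly measurable one $\{M_{a|x}\}$ with $\mathrm{tr}[\mathcal L(\rho)E_{a|x}]=\mathrm{tr}[\rho M_{a|x}]$ for all states $\rho$ and all $a,x$; a channel has incompatibility preservability if it is not in $\mathbf{IA}$. Define $$\mathcal R(\mathcal N):=\min\Big\{t\ge 0 \;\Big|\; \tfrac{\mathcal N+t\mathcal W}{1+t}\in\mathbf{IA}\text{ for some channel }\mathcal W\Big\},\qquad \mathcal F_+(\mathcal N):=\langle\Phi^+|(\mathcal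 N\otimes\mathcal I)(|\Phi^+\rangle\langle\Phi^+|)|\Phi^+\rangle,$$ where $|\Phi^+\rangle=\frac1{\sqrt d}\sum_{n=0}^{d-1}|nn\rangle$. Then the minimum defining $\mathcal R(\mathcal N)$ is attained, and $$1+\mathcal R(\mathcal N)\;\ge\;\mathcal F_+(\mathcal N)\,\frac{d\sqrt{d+1}}{d-1+\sqrt{d+1}}.$$ Moreover, $\mathcal N$ has incompatibility preservability whenever $$\mathcal F_+(\mathcal N)>\frac{d-1+\sqrt{d+1}}{d\sqrt{d+1}}.$$ The threshold on the right-hand side is asymptotically equivalent to $1/\sqrt d$, i.e. its ratio to $1/\sqrt d$ tends to $1$ as $d\to\infty$. -/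

import Mathlib

open scoped Matrix ComplexOrder

/-- A finite family `E` of complex matrices is a POVM: positive semidefinite effects that sum to
the identity. -/
def IsPOVM {n A : Type} [Fintype n] [DecidableEq n] [Fintype A]
    (E : A → Matrix n n ℂ) : Prop :=
  (∀ a, (E a).PosSemidef) ∧ ∑ a, E a = 1

/-- A measurement assemblage with settings `x : X` and outcomes `a : A`: for each setting `x`,
the family `E x` is a POVM. -/
def IsMeasurementAssemblage {n X A : Type} [Fintype n] [DecidableEq n] [Fintype A]
    (E : X → A → Matrix n n ℂ) : Prop :=
  ∀ x, IsPOVM (E x)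

/-- A measurement assemblage is jointly measurable if it is a classical post-processing
`P x l a = P(a|x,l)` of a single POVM `G`. -/
def IsJointlyMeasurable {n X A : Type} [Fintype n] [DecidableEq n] [Fintype A]
    (E : X → A → Matrix n n ℂ) : Prop :=
  IsMeasurementAssemblage E ∧
  ∃ (L : Type) (_ : Fintype L) (G : L → Matrix n n ℂ) (P : X → L → A → ℝ),
    IsPOVM G ∧
    (∀ x l a, 0 ≤ P x l a) ∧
    (∀ x l, ∑ a, P x l a = 1) ∧
    ∀ x a, E x a = ∑ l, P x l a • G l

/-- Density matrices. -/
def IsState {n : Type} [Fintype n] (ρ : Matrix n n ℂ) : Prop :=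
  ρ.PosSemidef ∧ ρ.trace = 1

/-- The map `N ⊗ id` on the bipartite system with index set `n × m`: the matrix `X`, viewed as an
`m × m` block matrix with `n × n` blocks, has `N` applied to each of its blocks. -/
def applyLocally {n m : Type} (N : Matrix n n ℂ →ₗ[ℂ] Matrix n n ℂ)
    (X : Matrix (n × m) (n × m) ℂ) : Matrix (n × m) (n × m) ℂ :=
  Matrix.of fun p q => N (Matrix.of fun i j => X (i, p.2) (j, q.2)) p.1 q.1

/-- Complete positivity: `N ⊗ id_k` preserves positive semidefiniteness for every `k`. -/
def IsCompletelyPositive {n : Type} [Fintype n]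
    (N : Matrix n n ℂ →ₗ[ℂ] Matrix n n ℂ) : Prop :=
  ∀ (k : ℕ) (X : Matrix (n × Fin k) (n × Fin k) ℂ),
    X.PosSemidef → (applyLocally N X).PosSemidef

/-- Quantum channels: completely positive trace-preserving linear maps. -/
def IsChannel {n : Type} [Fintype n] (N : Matrix n n ℂ →ₗ[ℂ] Matrix n n ℂ) : Prop :=
  IsCompletelyPositive N ∧ ∀ X, (N X).trace = X.trace

/-- The set of incompatibility-annihilating channels: for every measurement assemblage `E`
(finitely many settings and outcomes), the statistics of `E` after the channel are those of a
jointly measurable assemblage `M` on the input state. -/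
def IA (n : Type) [Fintype n] [DecidableEq n] : Set (Matrix n n ℂ →ₗ[ℂ] Matrix n n ℂ) :=
  {N | IsChannel N ∧
    ∀ (X A : Type) [Fintype X] [Fintype A] (E : X → A → Matrix n n ℂ),
      IsMeasurementAssemblage E →
      ∃ M : X → A → Matrix n n ℂ, IsJointlyMeasurable M ∧
        ∀ ρ : Matrix n n ℂ, IsState ρ → ∀ x a, (N ρ * E x a).trace = (ρ * M x a).trace}

/-- A channel has incompatibility preservability if it is not incompatibility-annihilating. -/
def HasIncompatibilityPreservability {n : Type} [Fintype n] [DecidableEq n]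
    (N : Matrix n n ℂ →ₗ[ℂ] Matrix n n ℂ) : Prop :=
  IsChannel N ∧ N ∉ IA n

/-- The weights `t ≥ 0` for which mixing `N` with some channel `W` in the proportion `1 : t` gives
an incompatibility-annihilating channel. -/
def annihilatingWeights {n : Type} [Fintype n] [DecidableEq n]
    (N : Matrix n n ℂ →ₗ[ℂ] Matrix n n ℂ) : Set ℝ :=
  {t | 0 ≤ t ∧ ∃ W : Matrix n n ℂ →ₗ[ℂ] Matrix n n ℂ,
    IsChannel W ∧ (1 + t)⁻¹ • (N + t • W) ∈ IA n}

/-- The incompatibility preservability robustness. -/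
noncomputable def robustness {n : Type} [Fintype n] [DecidableEq n]
    (N : Matrix n n ℂ →ₗ[ℂ] Matrix n n ℂ) : ℝ :=
  sInf (annihilatingWeights N)

/-- The maximally entangled vector `∑ i, |i i⟩ / √d`, where `d` is the cardinality of `n`. -/
noncomputable def maxEntangled (n : Type) [Fintype n] [DecidableEq n] : n × n → ℂ :=
  fun p => if p.1 = p.2 then ((1 / √(Fintype.card n : ℝ) : ℝ) : ℂ) else 0

/-- The singlet fraction `⟨Φ| (N ⊗ id)(|Φ⟩⟨Φ|) |Φ⟩`, where `Φ` is the maximally entangled vector;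
this number is real when `N` is a channel. -/
noncomputable def singletFraction {n : Type} [Fintype n] [DecidableEq n]
    (N : Matrix n n ℂ →ₗ[ℂ] Matrix n n ℂ) : ℝ :=
  (star (maxEntangled n) ⬝ᵥ
    (applyLocally N (Matrix.vecMulVec (maxEntangled n) (star (maxEntangled n))) *ᵥ
      maxEntangled n)).re

/-! ### Entrywise bounds and closedness for positive semidefinite matrices. -/

section PosSemidef

variable {n : Type}

/-! Prepare an effect of a weighted 2-design as input state, apply the channel, and measure in the
basis the effect came from. The 2-design identity makes the average success score an affine function
of the singlet fraction (`sum_trace_apply_mul`, `singletFraction_eq`). For an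
incompatibility-annihilating channel the score splits over the effects `G` of one parent POVM. For
each `G`, Cauchy–Schwarz on the centred variables `P - 1/d` and `tr(G E) - tr G / d` bounds its
share, the second moment of `tr(G E)` again coming from the design (`sum_mul_re_trace_mul_le`).
Summing over the parent POVM gives the threshold (`singletFraction_le_of_mem_IA`). The robustness
bound follows because the singlet fraction is linear and nonnegative on completely positive maps.

The design consists of the standard basis and the Fourier basis twisted by all diagonal phases that
are cube roots of unity (`isWeightedTwoDesign_phasedBases`).

The minimum is attained by compactness: channels, and parent POVMs with outcomes `X → A`, form
compact sets, so the admissible weights are a projection of a closed set along a compact factor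
(`isClosed_annihilatingWeights`). They are nonempty because a channel is one term of its own full
twirl (`annihilatingWeights_nonempty`). -/

theorem Matrix.PosSemidef.norm_sq_apply_le {A : Matrix n n ℂ} (hA : A.PosSemidef) (i j : n) :
    ‖A i j‖ ^ 2 ≤ (A i i).re * (A j j).re := by
  -- Nonnegativity of the 2×2 minor on rows `i`, `j`; no need for `i ≠ j`.
  have h := (hA.submatrix ![i, j]).det_nonneg
  have hji : A j i = star (A i j) := (hA.1.apply j i).symm
  have hi := Complex.nonneg_iff.mp (hA.diag_nonneg (i := i))
  have hj := Complex.nonneg_iff.mp (hA.diag_nonneg (i := j))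
  rw [Matrix.det_fin_two] at h
  simp only [Matrix.submatrix_apply, Matrix.cons_val_zero, Matrix.cons_val_one] at h
  rw [hji] at h
  have h' := (Complex.nonneg_iff.mp h).1
  have e : A i j * star (A i j) = ((‖A i j‖ ^ 2 : ℝ) : ℂ) := by
    rw [Complex.star_def, Complex.mul_conj, Complex.normSq_eq_norm_sq]
  rw [e, Complex.sub_re, Complex.mul_re, ← hi.2, ← hj.2, Complex.ofReal_re] at h'
  linarith

theorem Matrix.PosSemidef.re_apply_self_nonneg {A : Matrix n n ℂ} (hA : A.PosSemidef) (i : n) :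
    0 ≤ (A i i).re :=
  (Complex.nonneg_iff.mp (hA.diag_nonneg (i := i))).1

variable [Fintype n]

theorem Matrix.PosSemidef.norm_apply_le_trace {A : Matrix n n ℂ} (hA : A.PosSemidef) (i j : n) :
    ‖A i j‖ ≤ A.trace.re := by
  have h : ∀ i, (A i i).re ≤ A.trace.re := fun i => by
    rw [Matrix.trace, Complex.re_sum]
    exact Finset.single_le_sum (f := fun i => (A i i).re)
      (fun k _ => hA.re_apply_self_nonneg k) (Finset.mem_univ i)
  have h0 : 0 ≤ A.trace.re := (hA.re_apply_self_nonneg i).trans (h i)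
  refine le_of_sq_le_sq ?_ h0
  calc ‖A i j‖ ^ 2 ≤ (A i i).re * (A j j).re := hA.norm_sq_apply_le i j
    _ ≤ A.trace.re * A.trace.re := mul_le_mul (h i) (h j) (hA.re_apply_self_nonneg j) h0
    _ = A.trace.re ^ 2 := by ring

theorem Matrix.PosSemidef.re_trace_mul_self_le {A : Matrix n n ℂ} (hA : A.PosSemidef) :
    (A * A).trace.re ≤ A.trace.re ^ 2 := by
  have e : (A * A).trace.re = ∑ i, ∑ j, ‖A i j‖ ^ 2 := by
    simp only [Matrix.trace, Matrix.diag, Matrix.mul_apply, Complex.re_sum]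
    refine Finset.sum_congr rfl fun i _ => Finset.sum_congr rfl fun j _ => ?_
    rw [← hA.1.apply j i, Complex.star_def, Complex.mul_conj, Complex.normSq_eq_norm_sq,
      Complex.ofReal_re]
  rw [e, sq, Matrix.trace, Complex.re_sum, Finset.sum_mul_sum]
  exact Finset.sum_le_sum fun i _ => Finset.sum_le_sum fun j _ => hA.norm_sq_apply_le i j

theorem isClosed_setOf_posSemidef : IsClosed {A : Matrix n n ℂ | A.PosSemidef} := by
  have : OrderClosedTopology ℂ := Complex.orderClosedTopology
  have e : {A : Matrix n n ℂ | A.PosSemidef} =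
      {A | Aᴴ = A} ∩ ⋂ x : n → ℂ, {A | 0 ≤ star x ⬝ᵥ (A *ᵥ x)} := by
    ext A
    simp [Matrix.posSemidef_iff_dotProduct_mulVec, Matrix.IsHermitian]
  rw [e]
  refine (isClosed_eq (by fun_prop) continuous_id).inter (isClosed_iInter fun x => ?_)
  exact isClosed_le continuous_const
    (continuous_const.dotProduct (continuous_id.matrix_mulVec continuous_const))

end PosSemidef

/-! ### Channels in tensor coordinates, and their compactness. -/

section Channel

variable {n m : Type}

theorem applyLocally_add (N L : Matrix n n ℂ →ₗ[ℂ] Matrix n n ℂ) (X : Matrix (n × m) (n × m) ℂ) :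
    applyLocally (N + L) X = applyLocally N X + applyLocally L X := rfl

theorem applyLocally_smul (c : ℝ) (N : Matrix n n ℂ →ₗ[ℂ] Matrix n n ℂ)
    (X : Matrix (n × m) (n × m) ℂ) : applyLocally (c • N) X = c • applyLocally N X := rfl

theorem applyLocally_zero (X : Matrix (n × m) (n × m) ℂ) :
    applyLocally (0 : Matrix n n ℂ →ₗ[ℂ] Matrix n n ℂ) X = 0 := rfl

theorem applyLocally_comp (N L : Matrix n n ℂ →ₗ[ℂ] Matrix n n ℂ)
    (X : Matrix (n × m) (n × m) ℂ) :
    applyLocally (N ∘ₗ L) X = applyLocally N (applyLocally L X) := rfl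

variable [Fintype n]

namespace IsCompletelyPositive

variable {N L : Matrix n n ℂ →ₗ[ℂ] Matrix n n ℂ}

theorem add (hN : IsCompletelyPositive N) (hL : IsCompletelyPositive L) :
    IsCompletelyPositive (N + L) := fun k X hX => by
  rw [applyLocally_add]
  exact (hN k X hX).add (hL k X hX)

theorem smul {c : ℝ} (hc : 0 ≤ c) (hN : IsCompletelyPositive N) :
    IsCompletelyPositive (c • N) := fun k X hX => by
  rw [applyLocally_smul]
  exact (hN k X hX).smul hc

theorem zero : IsCompletelyPositive (0 : Matrix n n ℂ →ₗ[ℂ] Matrix n n ℂ) := fun k X _ => by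
  rw [applyLocally_zero]
  exact Matrix.PosSemidef.zero

theorem comp (hN : IsCompletelyPositive N) (hL : IsCompletelyPositive L) :
    IsCompletelyPositive (N ∘ₗ L) := fun k X hX => by
  rw [applyLocally_comp]
  exact hN k _ (hL k X hX)

theorem sum {ι : Type} (s : Finset ι) (T : ι → Matrix n n ℂ →ₗ[ℂ] Matrix n n ℂ)
    (h : ∀ i ∈ s, IsCompletelyPositive (T i)) : IsCompletelyPositive (∑ i ∈ s, T i) := by
  classical
  induction s using Finset.induction_on with
  | empty => simpa using zero
  | insert a s ha ih =>
    rw [Finset.sum_insert ha]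
    exact (h a (Finset.mem_insert_self a s)).add
      (ih fun i hi => h i (Finset.mem_insert_of_mem hi))

/-- Completely positive maps preserve positivity with any finite ancilla. -/
theorem posSemidef_applyLocally [Fintype m] (hN : IsCompletelyPositive N)
    {X : Matrix (n × m) (n × m) ℂ} (hX : X.PosSemidef) : (applyLocally N X).PosSemidef := by
  have e := Fintype.equivFin m
  have h := hN (Fintype.card m) _ (hX.submatrix (Prod.map id e.symm))
  have h' := h.submatrix (Prod.map (id : n → n) e)
  convert h' using 1
  ext p q
  simp [applyLocally, Matrix.submatrix]

end IsCompletelyPositive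

theorem IsChannel.convexCombination {N W : Matrix n n ℂ →ₗ[ℂ] Matrix n n ℂ} (hN : IsChannel N)
    (hW : IsChannel W) {t : ℝ} (ht : 0 ≤ t) : IsChannel ((1 + t)⁻¹ • (N + t • W)) := by
  refine ⟨(hN.1.add (hW.1.smul ht)).smul (by positivity), fun X => ?_⟩
  have h1 : ((1 : ℂ) + t) ≠ 0 := by
    have : (1 + t : ℝ) ≠ 0 := by positivity
    exact_mod_cast this
  simp only [LinearMap.smul_apply, LinearMap.add_apply, Matrix.trace_smul, Matrix.trace_add,
    hN.2 X, hW.2 X, Complex.real_smul]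
  push_cast
  field_simp

/-- The linear map on matrices whose matrix elements are given by the tensor `J`. -/
noncomputable def ofTensor (J : n → n → n → n → ℂ) : Matrix n n ℂ →ₗ[ℂ] Matrix n n ℂ where
  toFun X := Matrix.of fun i j => ∑ k, ∑ l, J i j k l * X k l
  map_add' X Y := by
    ext i j
    simp [mul_add, Finset.sum_add_distrib]
  map_smul' c X := by
    ext i j
    simp [Finset.mul_sum, mul_left_comm]

theorem ofTensor_apply (J : n → n → n → n → ℂ) (X : Matrix n n ℂ) (i j : n) :
    ofTensor J X i j = ∑ k, ∑ l, J i j k l * X k l := rfl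

theorem continuous_ofTensor_apply (X : Matrix n n ℂ) :
    Continuous fun J : n → n → n → n → ℂ => ofTensor J X := by
  refine continuous_matrix fun i j => ?_
  simp only [ofTensor_apply]
  fun_prop

theorem isClosed_setOf_isChannel_ofTensor :
    IsClosed {J : n → n → n → n → ℂ | IsChannel (ofTensor J)} := by
  have e : {J : n → n → n → n → ℂ | IsChannel (ofTensor J)} =
      (⋂ (k : ℕ) (X : Matrix (n × Fin k) (n × Fin k) ℂ) (_ : X.PosSemidef),
        {J | (applyLocally (ofTensor J) X).PosSemidef}) ∩
      ⋂ X : Matrix n n ℂ, {J | (ofTensor J X).trace = X.trace} := by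
    ext J
    simp [IsChannel, IsCompletelyPositive]
  rw [e]
  refine IsClosed.inter (isClosed_iInter fun k => isClosed_iInter fun X => isClosed_iInter fun _ =>
    isClosed_setOf_posSemidef.preimage (continuous_matrix fun p q => ?_))
    (isClosed_iInter fun X => isClosed_eq (continuous_ofTensor_apply X).matrix_trace
      continuous_const)
  exact (continuous_ofTensor_apply _).matrix_elem p.1 q.1

variable [DecidableEq n]

/-- The tensor of matrix elements of a linear map on matrices. -/
def toTensor (N : Matrix n n ℂ →ₗ[ℂ] Matrix n n ℂ) (i j k l : n) : ℂ := N (Matrix.single k l 1) i j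

theorem apply_eq_sum_toTensor (N : Matrix n n ℂ →ₗ[ℂ] Matrix n n ℂ) (X : Matrix n n ℂ) (i j : n) :
    N X i j = ∑ k, ∑ l, toTensor N i j k l * X k l := by
  conv_lhs => rw [Matrix.matrix_eq_sum_single X]
  simp only [map_sum, Matrix.sum_apply, toTensor]
  refine Finset.sum_congr rfl fun k _ => Finset.sum_congr rfl fun l _ => ?_
  have : Matrix.single k l (X k l) = X k l • Matrix.single k l (1 : ℂ) := by
    rw [Matrix.smul_single, smul_eq_mul, mul_one]
  rw [this, map_smul, Matrix.smul_apply, smul_eq_mul, mul_comm]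

theorem ofTensor_toTensor (N : Matrix n n ℂ →ₗ[ℂ] Matrix n n ℂ) : ofTensor (toTensor N) = N := by
  ext X i j : 3
  rw [ofTensor_apply, apply_eq_sum_toTensor]

/-- The tensor entries are those of the Choi matrix, which is positive semidefinite with trace `d`,
so each is bounded by that trace. -/
theorem IsChannel.norm_toTensor_le {N : Matrix n n ℂ →ₗ[ℂ] Matrix n n ℂ} (hN : IsChannel N)
    (i j k l : n) : ‖toTensor N i j k l‖ ≤ Fintype.card n := by
  let v : n × n → ℂ := fun p => if p.1 = p.2 then 1 else 0
  have h := hN.1.posSemidef_applyLocally (Matrix.posSemidef_vecMulVec_self_star v)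
  have hblock : ∀ k l : n, (Matrix.of fun i j => Matrix.vecMulVec v (star v) (i, k) (j, l)) =
      Matrix.single k l (1 : ℂ) := by
    intro k l
    ext i j
    simp only [Matrix.of_apply, Matrix.vecMulVec_apply, v, Pi.star_apply, Matrix.single_apply]
    simp [eq_comm (a := k), eq_comm (a := l), ← ite_and, and_comm]
  have h1 := h.norm_apply_le_trace (i, k) (j, l)
  have e : applyLocally N (Matrix.vecMulVec v (star v)) (i, k) (j, l) = toTensor N i j k l := by
    simp only [applyLocally, Matrix.of_apply, toTensor]
    rw [hblock]
  rw [e] at h1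
  refine h1.trans (le_of_eq ?_)
  have : (applyLocally N (Matrix.vecMulVec v (star v))).trace = Fintype.card n := by
    simp only [Matrix.trace, Matrix.diag, applyLocally, Matrix.of_apply]
    rw [Fintype.sum_prod_type_right]
    simp only [hblock]
    have : ∀ k : n, ∑ i, N (Matrix.single k k 1) i i = 1 := fun k => by
      have := hN.2 (Matrix.single k k 1)
      rw [Matrix.trace_single_eq_same] at this
      exact this
    simp [this]
  rw [this]
  simp

theorem isCompact_setOf_isChannel_ofTensor :
    IsCompact {J : n → n → n → n → ℂ | IsChannel (ofTensor J)} := by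
  refine Metric.isCompact_of_isClosed_isBounded isClosed_setOf_isChannel_ofTensor ?_
  refine (Metric.isBounded_closedBall (x := 0) (r := (Fintype.card n : ℝ))).subset fun J hJ => ?_
  have hc : (0 : ℝ) ≤ Fintype.card n := Nat.cast_nonneg _
  rw [mem_closedBall_zero_iff]
  simp only [pi_norm_le_iff_of_nonneg hc]
  intro i j k l
  have h := hJ.norm_toTensor_le i j k l
  have e : toTensor (ofTensor J) i j k l = J i j k l := by
    simp [toTensor, ofTensor_apply, Matrix.single_apply, ite_and]
  rwa [e] at h

end Channel

/-! ### Joint measurability through deterministic responses. -/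

section JointMeasurability

variable {n X A : Type} [Fintype n] [DecidableEq n] [Fintype X] [DecidableEq X] [Fintype A]
  [DecidableEq A]

/-- The marginal of a product distribution. -/
theorem sum_ite_prod_eq_of_sum_eq_one {P : X → A → ℝ} (hP : ∀ x, ∑ a, P x a = 1) (x : X) (a : A) :
    (∑ f : X → A, if f x = a then ∏ y, P y (f y) else 0) = P x a := by
  -- Absorbing the constraint `f x = a` into the factor at `x` lets the sum over `f` factor into a
  -- product of sums.
  let Q : X → A → ℝ := fun y b => if y = x ∧ b ≠ a then 0 else P y b
  have h : ∀ f : X → A, (if f x = a then ∏ y, P y (f y) else 0) = ∏ y, Q y (f y) := by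
    intro f
    split_ifs with hf
    · refine Finset.prod_congr rfl fun y _ => ?_
      have : ¬ (y = x ∧ f y ≠ a) := fun ⟨h1, h2⟩ => h2 (h1 ▸ hf)
      simp only [Q, if_neg this]
    · symm
      exact Finset.prod_eq_zero (Finset.mem_univ x) (by simp [Q, hf])
  simp only [h]
  rw [← Fintype.piFinset_univ, ← Finset.prod_univ_sum, Finset.prod_eq_single x]
  · rw [Finset.sum_eq_single a] <;> simp +contextual [Q]
  · intro y _ hy
    simp [Q, hy, hP]
  · simp

theorem IsPOVM.isMeasurementAssemblage_marginal {G : (X → A) → Matrix n n ℂ} (hG : IsPOVM G) :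
    IsMeasurementAssemblage fun (x : X) (a : A) => ∑ f, if f x = a then G f else 0 := by
  intro x
  refine ⟨fun a => Matrix.posSemidef_sum _ fun f _ => ?_, ?_⟩
  · split_ifs
    · exact hG.1 f
    · exact Matrix.PosSemidef.zero
  · rw [Finset.sum_comm]
    simpa using hG.2

/-- Joint measurability is equivalent to the existence of a POVM whose outcomes are the
deterministic assignments of outcomes to settings and whose marginals are the assemblage. -/
theorem isJointlyMeasurable_iff {M : X → A → Matrix n n ℂ} :
    IsJointlyMeasurable M ↔ ∃ G : (X → A) → Matrix n n ℂ, IsPOVM G ∧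
      M = fun x a => ∑ f, if f x = a then G f else 0 := by
  constructor
  · rintro ⟨-, L, _, G, P, hG, hP0, hP1, hM⟩
    -- Given `l`, the outcomes for all settings are drawn independently and recorded together as
    -- `f`.
    refine ⟨fun f => ∑ l, (∏ x, P x l (f x)) • G l, ⟨fun f => Matrix.posSemidef_sum _ fun l _ =>
      (hG.1 l).smul (Finset.prod_nonneg fun x _ => hP0 x l (f x)), ?_⟩, ?_⟩
    · rw [Finset.sum_comm]
      simp only [← Finset.sum_smul]
      rw [← hG.2]
      refine Finset.sum_congr rfl fun l _ => ?_
      rw [← Fintype.piFinset_univ, ← Finset.prod_univ_sum]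
      simp [hP1]
    · ext1 x
      ext1 a
      rw [hM]
      have : ∀ f : X → A, (if f x = a then ∑ l, (∏ x, P x l (f x)) • G l else 0) =
          ∑ l, (if f x = a then ∏ x, P x l (f x) else 0) • G l := fun f => by
        split_ifs <;> simp
      simp only [this]
      rw [Finset.sum_comm]
      refine Finset.sum_congr rfl fun l _ => ?_
      rw [← Finset.sum_smul, sum_ite_prod_eq_of_sum_eq_one (P := fun x => P x l) (hP1 · l)]
  · rintro ⟨G, hG, rfl⟩
    refine ⟨hG.isMeasurementAssemblage_marginal, X → A, inferInstance, G,
      fun x f a => if f x = a then 1 else 0, hG, fun x l a => by positivity, fun x l => by simp,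
      fun x a => by simp⟩

theorem isCompact_setOf_isPOVM (n A : Type) [Fintype n] [DecidableEq n] [Fintype A] :
    IsCompact {G : A → n → n → ℂ | IsPOVM fun a => Matrix.of (G a)} := by
  refine Metric.isCompact_of_isClosed_isBounded ?_ ?_
  · have e : {G : A → n → n → ℂ | IsPOVM fun a => Matrix.of (G a)} =
        (⋂ a, {G | (Matrix.of (G a)).PosSemidef}) ∩ {G | ∑ a, Matrix.of (G a) = 1} := by
      ext G
      simp [IsPOVM]
    rw [e]
    have hc : ∀ a, Continuous fun G : A → n → n → ℂ => (Matrix.of (G a) : Matrix n n ℂ) :=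
      fun a => continuous_apply a
    exact (isClosed_iInter fun a => isClosed_setOf_posSemidef.preimage (hc a)).inter
      (isClosed_eq (continuous_finsetSum _ fun a _ => hc a) continuous_const)
  · refine (Metric.isBounded_closedBall (x := 0) (r := (Fintype.card n : ℝ))).subset fun G hG => ?_
    have hc : (0 : ℝ) ≤ Fintype.card n := Nat.cast_nonneg _
    rw [mem_closedBall_zero_iff]
    simp only [pi_norm_le_iff_of_nonneg hc]
    intro a i j
    refine ((hG.1 a).norm_apply_le_trace i j).trans ?_
    have h := congrArg (fun B : Matrix n n ℂ => B.trace.re) hG.2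
    simp only [Matrix.trace_sum, Matrix.trace_one, Complex.re_sum, Complex.natCast_re] at h
    rw [← h]
    exact Finset.single_le_sum (f := fun a => (Matrix.of (G a)).trace.re)
      (fun b _ => (Complex.nonneg_iff.mp (hG.1 b).trace_nonneg).1) (Finset.mem_univ a)

end JointMeasurability

/-! ### Closedness by projection along compact factors. -/

section Closedness

variable {n : Type} [Fintype n] [DecidableEq n]

/-- For a fixed assemblage, the parent POVM may be taken with outcomes `X → A`, hence in one fixed
compact set; projecting the closed compatibility relation along it stays closed. -/
theorem isClosed_setOf_ofTensor_mem_IA :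
    IsClosed {J : n → n → n → n → ℂ | ofTensor J ∈ IA n} := by
  classical
  have e : {J : n → n → n → n → ℂ | ofTensor J ∈ IA n} = {J | IsChannel (ofTensor J)} ∩
      ⋂ (X : Type) (A : Type) (_ : Fintype X) (_ : Fintype A) (E : X → A → Matrix n n ℂ)
        (_ : IsMeasurementAssemblage E), {J | ∃ M : X → A → Matrix n n ℂ, IsJointlyMeasurable M ∧
        ∀ ρ : Matrix n n ℂ, IsState ρ → ∀ x a,
          (ofTensor J ρ * E x a).trace = (ρ * M x a).trace} := by
    ext J
    simp [IA]
  rw [e]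
  refine isClosed_setOf_isChannel_ofTensor.inter <| isClosed_iInter fun X => isClosed_iInter fun A =>
    isClosed_iInter fun _ => isClosed_iInter fun _ => isClosed_iInter fun E =>
    isClosed_iInter fun _ => ?_
  let K : Set ((X → A) → n → n → ℂ) := {G | IsPOVM fun a => Matrix.of (G a)}
  have : CompactSpace K := isCompact_iff_compactSpace.mp (isCompact_setOf_isPOVM n (X → A))
  let C : Set ((n → n → n → n → ℂ) × K) := ⋂ (ρ : Matrix n n ℂ) (_ : IsState ρ) (x : X) (a : A),
    {p | (ofTensor p.1 ρ * E x a).trace =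
      (ρ * ∑ f : X → A, if f x = a then Matrix.of (p.2.1 f) else 0).trace}
  have hC : IsClosed C := by
    refine isClosed_iInter fun ρ => isClosed_iInter fun _ => isClosed_iInter fun x =>
      isClosed_iInter fun a => isClosed_eq ?_ ?_
    · exact (((continuous_ofTensor_apply ρ).comp continuous_fst).matrix_mul
        continuous_const).matrix_trace
    · refine (continuous_const.matrix_mul (continuous_finsetSum _ fun f _ => ?_)).matrix_trace
      split_ifs
      · exact (continuous_apply f).comp (continuous_subtype_val.comp continuous_snd)
      · exact continuous_const
  convert isClosedMap_fst_of_compactSpace C hC using 1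
  ext J
  simp only [Set.mem_ofPred_eq, Set.mem_image, Prod.exists, exists_and_right, exists_eq_right]
  constructor
  · rintro ⟨M, hM, h⟩
    obtain ⟨G, hG, rfl⟩ := isJointlyMeasurable_iff.mp hM
    refine ⟨⟨G, hG⟩, ?_⟩
    simp only [C, Set.mem_iInter]
    exact fun ρ hρ x a => h ρ hρ x a
  · rintro ⟨⟨G, hG⟩, h⟩
    simp only [C, Set.mem_iInter] at h
    exact ⟨_, isJointlyMeasurable_iff.mpr ⟨_, hG, rfl⟩, fun ρ hρ x a => h ρ hρ x a⟩

theorem isClosed_annihilatingWeights (N : Matrix n n ℂ →ₗ[ℂ] Matrix n n ℂ) :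
    IsClosed (annihilatingWeights N) := by
  let K : Set (n → n → n → n → ℂ) := {J | IsChannel (ofTensor J)}
  have : CompactSpace K := isCompact_iff_compactSpace.mp isCompact_setOf_isChannel_ofTensor
  let φ : ℝ × K → n → n → n → n → ℂ := fun p => (1 + p.1)⁻¹ • (toTensor N + p.1 • p.2.1)
  -- Continuity is only claimed for `t ≥ 0`, since the inverse breaks at `t = -1`.
  have hφ : ContinuousOn φ (Set.Ici 0 ×ˢ Set.univ) := by
    have h1 : Continuous fun p : ℝ × K => 1 + p.1 := by fun_prop
    have h2 : Continuous fun p : ℝ × K => toTensor N + p.1 • p.2.1 :=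
      continuous_const.add (continuous_fst.smul (continuous_subtype_val.comp continuous_snd))
    refine (h1.continuousOn.inv₀ fun p hp => ?_).smul h2.continuousOn
    have : (0 : ℝ) ≤ p.1 := hp.1
    positivity
  have hof : ∀ p, ofTensor (φ p) = (1 + p.1)⁻¹ • (N + p.1 • ofTensor p.2.1) := by
    intro p
    ext Y i j : 3
    rw [LinearMap.smul_apply, LinearMap.add_apply, LinearMap.smul_apply, Matrix.smul_apply,
      Matrix.add_apply, Matrix.smul_apply, ofTensor_apply, ofTensor_apply, apply_eq_sum_toTensor]
    simp only [φ, Pi.smul_apply, Pi.add_apply, Complex.real_smul, Finset.mul_sum,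
      ← Finset.sum_add_distrib]
    refine Finset.sum_congr rfl fun k _ => Finset.sum_congr rfl fun l _ => ?_
    ring
  have hC := hφ.preimage_isClosed_of_isClosed (isClosed_Ici.prod isClosed_univ)
    (isClosed_setOf_ofTensor_mem_IA (n := n))
  convert isClosedMap_fst_of_compactSpace _ hC using 1
  ext t
  simp only [annihilatingWeights, Set.mem_ofPred_eq, Set.mem_image, Prod.exists, exists_and_right,
    exists_eq_right, Set.mem_inter_iff, Set.mem_prod, Set.mem_Ici, Set.mem_univ, and_true,
    Set.mem_preimage, hof, Subtype.exists, exists_and_left]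
  refine and_congr_right fun _ => ⟨fun ⟨W, hW, h⟩ => ⟨toTensor W, ?_, ?_⟩, fun ⟨J, hJ, h⟩ =>
    ⟨_, hJ, h⟩⟩
  · change IsChannel (ofTensor (toTensor W))
    rwa [ofTensor_toTensor]
  · simpa only [ofTensor_toTensor] using h

end Closedness

/-! ### Moments of random cube-root phases. -/

section Phases

variable {n : Type}

/-- Diagonal phases given by third roots of unity. -/
noncomputable def cubicPhase (z : n → ZMod 3) (i : n) : ℂ := ZMod.stdAddChar (z i)

theorem star_cubicPhase (z : n → ZMod 3) (i : n) :
    star (cubicPhase z i) = ZMod.stdAddChar (-(z i)) := by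
  rw [cubicPhase, AddChar.map_neg_eq_conj, Complex.star_def]

theorem cubicPhase_mul_star_self (z : n → ZMod 3) (i : n) :
    cubicPhase z i * star (cubicPhase z i) = 1 := by
  rw [star_cubicPhase, cubicPhase, ← AddChar.map_add_eq_mul, add_neg_cancel,
    AddChar.map_zero_eq_one]

variable [Fintype n] [DecidableEq n]

/-- Independent uniform third roots of unity have the fourth moments of independent uniform
phases. -/
theorem sum_cubicPhase_four (i j k l : n) :
    ∑ z : n → ZMod 3, cubicPhase z i * star (cubicPhase z j) *
      (cubicPhase z k * star (cubicPhase z l)) =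
    if (i = j ∧ k = l) ∨ (i = l ∧ k = j) then 3 ^ Fintype.card n else 0 := by
  let φ : (n → ZMod 3) →+ ZMod 3 :=
    Pi.evalAddMonoidHom (fun _ => ZMod 3) i - Pi.evalAddMonoidHom (fun _ => ZMod 3) j +
      (Pi.evalAddMonoidHom (fun _ => ZMod 3) k - Pi.evalAddMonoidHom (fun _ => ZMod 3) l)
  -- The summand is a character of `(ZMod 3)^n`, so the sum vanishes unless the character is
  -- trivial.
  let ψ : AddChar (n → ZMod 3) ℂ := (ZMod.stdAddChar (N := 3)).compAddMonoidHom φ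
  have h1 : ∀ z : n → ZMod 3, cubicPhase z i * star (cubicPhase z j) *
      (cubicPhase z k * star (cubicPhase z l)) = ψ z := fun z => by
    rw [star_cubicPhase, star_cubicPhase]
    simp only [cubicPhase, ← AddChar.map_add_eq_mul, ← sub_eq_add_neg]
    rfl
  have h2 : ψ = 0 ↔ (i = j ∧ k = l) ∨ (i = l ∧ k = j) := by
    have h3 : ψ = 0 ↔ ∀ z : n → ZMod 3, z i - z j + (z k - z l) = 0 := by
      rw [DFunLike.ext_iff]
      refine forall_congr' fun z => ?_
      rw [AddChar.zero_apply, ← AddChar.map_zero_eq_one (ZMod.stdAddChar (N := 3))]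
      exact ZMod.injective_stdAddChar.eq_iff
    rw [h3]
    constructor
    · intro h
      by_cases hij : i = j
      · subst hij
        have := h (Pi.single k 1)
        by_cases hkl : k = l
        · exact Or.inl ⟨rfl, hkl⟩
        · simp [Pi.single_apply, Ne.symm hkl] at this
      · right
        have hi := h (Pi.single i 1)
        have hj := h (Pi.single j 1)
        simp only [Pi.single_apply, hij, Ne.symm hij, if_true, if_false] at hi hj
        have hl : l = i := by
          by_contra hl
          rw [if_neg hl] at hi
          -- The values left are 1 and 2, both nonzero mod 3; with signs ±1 the value 2 would vanish
          -- and spoil the moment.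
          split_ifs at hi <;> revert hi <;> decide
        subst hl
        rw [if_neg hij] at hj
        refine ⟨rfl, ?_⟩
        by_contra hk
        rw [if_neg hk] at hj
        revert hj
        decide
    · rintro (⟨rfl, rfl⟩ | ⟨rfl, rfl⟩) z <;> ring
  classical
  simp only [h1]
  rw [AddChar.sum_eq_ite]
  simp only [h2]
  simp

theorem sum_cubicPhase_two (i j : n) :
    ∑ z : n → ZMod 3, cubicPhase z i * star (cubicPhase z j) =
    if i = j then 3 ^ Fintype.card n else 0 := by
  have h := sum_cubicPhase_four i j i i
  simp only [cubicPhase_mul_star_self, mul_one] at h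
  rw [h]
  exact if_congr ⟨fun h => h.elim (·.1) (·.2), fun h => Or.inl ⟨h, trivial⟩⟩ rfl rfl

end Phases

/-- The output ignores the input state, so every measurement becomes a classical coin toss, obtained
from a one-outcome parent POVM. -/
theorem mem_IA_of_forall_eq_trace_smul_one {n : Type} [Fintype n] [DecidableEq n]
    {L : Matrix n n ℂ →ₗ[ℂ] Matrix n n ℂ} (hL : IsChannel L) {c : ℝ} (hc : 0 ≤ c) (hcn : c * Fintype.card n = 1)
    (h : ∀ X, L X = (c * X.trace) • (1 : Matrix n n ℂ)) : L ∈ IA n := by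
  refine ⟨hL, fun X A _ _ E hE => ⟨fun x a => (c * (E x a).trace.re) • (1 : Matrix n n ℂ),
    ?_, ?_⟩⟩
  · have hP0 : ∀ x a, 0 ≤ c * (E x a).trace.re := fun x a =>
      mul_nonneg hc (Complex.nonneg_iff.mp ((hE x).1 a).trace_nonneg).1
    have hP1 : ∀ x, ∑ a, c * (E x a).trace.re = 1 := fun x => by
      rw [← Finset.mul_sum, ← Complex.re_sum, ← Matrix.trace_sum, (hE x).2, Matrix.trace_one,
        Complex.natCast_re, hcn]
    refine ⟨fun x => ⟨fun a => Matrix.PosSemidef.one.smul (hP0 x a), ?_⟩,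
      Unit, inferInstance, fun _ => 1, fun x _ a => c * (E x a).trace.re,
      ⟨fun _ => Matrix.PosSemidef.one, by simp⟩, fun x _ a => hP0 x a, fun x _ => hP1 x,
      fun x a => by simp⟩
    rw [← Finset.sum_smul, hP1, one_smul]
  · intro ρ hρ x a
    have hreal : (((E x a).trace.re : ℝ) : ℂ) = (E x a).trace :=
      Complex.ext rfl (Complex.nonneg_iff.mp ((hE x).1 a).trace_nonneg).2
    rw [h, hρ.2, mul_one, Matrix.smul_mul, one_mul, Matrix.trace_smul, Matrix.mul_smul,
      Matrix.trace_smul, mul_one, hρ.2, smul_eq_mul, Complex.real_smul, mul_one,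
      Complex.ofReal_mul, hreal]

/-! ### Twirling to the depolarizing channel; attainment of the minimum. -/

section Twirl

variable {n : Type} [AddCommGroup n]

/-- Conjugation by a cyclic shift followed by a diagonal phase. -/
noncomputable def phaseShift (p : (n → ZMod 3) × n) : Matrix n n ℂ →ₗ[ℂ] Matrix n n ℂ where
  toFun X := Matrix.of fun i j =>
    cubicPhase p.1 i * star (cubicPhase p.1 j) * X (i + p.2) (j + p.2)
  map_add' X Y := by
    ext i j
    simp [mul_add]
  map_smul' c X := by
    ext i j
    simp [mul_left_comm]

theorem phaseShift_apply (p : (n → ZMod 3) × n) (X : Matrix n n ℂ) (i j : n) :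
    phaseShift p X i j = cubicPhase p.1 i * star (cubicPhase p.1 j) * X (i + p.2) (j + p.2) := rfl

theorem phaseShift_zero : phaseShift (0 : (n → ZMod 3) × n) = LinearMap.id := by
  ext X i j : 3
  simp [phaseShift_apply, cubicPhase]

variable [Fintype n]

theorem isChannel_phaseShift (p : (n → ZMod 3) × n) : IsChannel (phaseShift p) := by
  classical
  constructor
  · intro k X hX
    let D : Matrix (n × Fin k) (n × Fin k) ℂ := Matrix.diagonal fun q => cubicPhase p.1 q.1
    convert (hX.submatrix fun q : n × Fin k => (q.1 + p.2, q.2)).mul_mul_conjTranspose_same D using 1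
    ext q r
    simp only [applyLocally, Matrix.of_apply, phaseShift_apply, D, Matrix.diagonal_conjTranspose,
      Matrix.mul_diagonal, Matrix.diagonal_mul, Matrix.submatrix_apply, Pi.star_apply]
    ring
  · intro X
    simp only [Matrix.trace, Matrix.diag, phaseShift_apply, cubicPhase_mul_star_self, one_mul]
    exact Fintype.sum_equiv (Equiv.addRight p.2) _ _ fun _ => rfl

variable [DecidableEq n]

/-- Averaging over phases kills the off-diagonal entries; averaging over shifts levels the diagonal.
-/
theorem sum_phaseShift_apply (X : Matrix n n ℂ) :
    ∑ p, phaseShift p X = (3 ^ Fintype.card n * X.trace) • (1 : Matrix n n ℂ) := by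
  ext i j
  rw [Matrix.sum_apply, Fintype.sum_prod_type_right]
  simp only [phaseShift_apply, ← Finset.sum_mul, sum_cubicPhase_two]
  rw [← Finset.mul_sum, Matrix.smul_apply, Matrix.one_apply]
  split_ifs with h
  · subst h
    have : ∑ s, X (i + s) (i + s) = X.trace :=
      Fintype.sum_equiv (Equiv.addLeft i) _ _ fun _ => rfl
    rw [this, smul_eq_mul, mul_one]
  · simp

/-- The term `p = 0` of the twirl of `N` is `N` itself. The normalised sum of the other terms serves
as `W`, with `t` their number, and the mixture is completely depolarizing. -/
theorem annihilatingWeights_nonempty {N : Matrix n n ℂ →ₗ[ℂ] Matrix n n ℂ} (hN : IsChannel N) :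
    (annihilatingWeights N).Nonempty := by
  let s : Finset ((n → ZMod 3) × n) := Finset.univ.erase 0
  let t : ℝ := s.card
  have hcard : 1 + t = 3 ^ Fintype.card n * Fintype.card n := by
    have h := Finset.card_erase_add_one (Finset.mem_univ (0 : (n → ZMod 3) × n))
    rw [Finset.card_univ, Fintype.card_prod, Fintype.card_fun, ZMod.card] at h
    rw [add_comm]
    simp only [t, s]
    exact_mod_cast h
  have hn : 0 < Fintype.card n := Fintype.card_pos
  have ht : 0 < t := by
    have h1 : (3 : ℝ) ≤ 3 ^ Fintype.card n := by
      simpa using pow_le_pow_right₀ (by norm_num : (1 : ℝ) ≤ 3) hn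
    have h2 : (1 : ℝ) ≤ Fintype.card n := by exact_mod_cast hn
    nlinarith
  let W : Matrix n n ℂ →ₗ[ℂ] Matrix n n ℂ := t⁻¹ • ∑ p ∈ s, phaseShift p ∘ₗ N
  have hW : IsChannel W := by
    refine ⟨(IsCompletelyPositive.sum s _ fun p _ => (isChannel_phaseShift p).1.comp hN.1).smul
      (inv_nonneg.mpr ht.le), fun X => ?_⟩
    simp only [W, LinearMap.smul_apply, LinearMap.sum_apply, LinearMap.comp_apply,
      Matrix.trace_smul, Matrix.trace_sum, (isChannel_phaseShift _).2, hN.2, Finset.sum_const]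
    rw [← Nat.cast_smul_eq_nsmul ℝ, smul_smul]
    change (t⁻¹ * t) • _ = _
    rw [inv_mul_cancel₀ ht.ne', one_smul]
  have hsum : N + t • W = ∑ p, phaseShift p ∘ₗ N := by
    simp only [W]
    rw [smul_smul, mul_inv_cancel₀ ht.ne', one_smul, ← Finset.add_sum_erase _ _
      (Finset.mem_univ (0 : (n → ZMod 3) × n)), phaseShift_zero, LinearMap.id_comp]
  refine ⟨t, ht.le, W, hW, ?_⟩
  have hn' : (Fintype.card n : ℂ) ≠ 0 := by exact_mod_cast hn.ne'
  refine mem_IA_of_forall_eq_trace_smul_one (hN.convexCombination hW ht.le)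
    (c := (Fintype.card n : ℝ)⁻¹) (by positivity) (inv_mul_cancel₀ (by exact_mod_cast hn.ne')) ?_
  intro X
  rw [hsum, hcard, LinearMap.smul_apply, LinearMap.sum_apply]
  simp only [LinearMap.comp_apply]
  rw [sum_phaseShift_apply, hN.2, ← Complex.coe_smul, smul_smul]
  congr 1
  push_cast
  field_simp

theorem isLeast_robustness {N : Matrix n n ℂ →ₗ[ℂ] Matrix n n ℂ} (hN : IsChannel N) :
    IsLeast (annihilatingWeights N) (robustness N) :=
  have hb : BddBelow (annihilatingWeights N) := ⟨0, fun _ ht => ht.1⟩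
  ⟨(isClosed_annihilatingWeights N).csInf_mem (annihilatingWeights_nonempty hN) hb,
    fun _ ht => csInf_le hb ht⟩

end Twirl

/-! ### Weighted 2-designs and the bound for a single parent effect. -/

section Design

variable {n X A : Type} [Fintype n] [DecidableEq n] [Fintype X] [Fintype A]

/-- A weighted family of POVMs with trace-one effects whose second moments are those of a complex
projective 2-design. -/
structure IsWeightedTwoDesign (w : X → ℝ) (E : X → A → Matrix n n ℂ) : Prop where
  nonneg : ∀ x, 0 ≤ w x
  sum_eq_one : ∑ x, w x = 1
  isMeasurementAssemblage : IsMeasurementAssemblage E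
  trace_eq_one : ∀ x a, (E x a).trace = 1
  sum_mul : ∀ i j k l, ∑ x, (w x : ℂ) * ∑ a, E x a i j * E x a k l =
    ((if i = j ∧ k = l then 1 else 0) + if i = l ∧ k = j then 1 else 0) / (Fintype.card n + 1)

namespace IsWeightedTwoDesign

variable {w : X → ℝ} {E : X → A → Matrix n n ℂ}

theorem sum_bilinear (h : IsWeightedTwoDesign w E) (B : n → n → n → n → ℂ) :
    ∑ x, (w x : ℂ) * ∑ a, ∑ i, ∑ j, ∑ k, ∑ l, B i j k l * (E x a i j * E x a k l) =
      (∑ i, ∑ k, B i i k k + ∑ i, ∑ j, B i j j i) / (Fintype.card n + 1) := by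
  have e1 : ∑ x, (w x : ℂ) * ∑ a, ∑ i, ∑ j, ∑ k, ∑ l, B i j k l * (E x a i j * E x a k l) =
      ∑ i, ∑ j, ∑ k, ∑ l, B i j k l * ∑ x, (w x : ℂ) * ∑ a, E x a i j * E x a k l := by
    simp only [Finset.mul_sum]
    simp only [Finset.sum_comm (s := (Finset.univ : Finset A)) (t := (Finset.univ : Finset n))]
    simp only [Finset.sum_comm (s := (Finset.univ : Finset X)) (t := (Finset.univ : Finset n))]
    simp only [mul_left_comm]
  rw [e1]
  simp only [h.sum_mul, mul_div_assoc', ← Finset.sum_div, mul_add, Finset.sum_add_distrib]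
  congr 2
  · simp [ite_and]
  · simp [ite_and]

theorem sum_trace_mul_sq (h : IsWeightedTwoDesign w E) (G : Matrix n n ℂ) :
    ∑ x, (w x : ℂ) * ∑ a, (G * E x a).trace ^ 2 =
      (G.trace ^ 2 + (G * G).trace) / (Fintype.card n + 1) := by
  have e := h.sum_bilinear fun i j k l => G j i * G l k
  have e1 : ∀ x a, (G * E x a).trace ^ 2 =
      ∑ i, ∑ j, ∑ k, ∑ l, G j i * G l k * (E x a i j * E x a k l) := fun x a => by
    have f : (G * E x a).trace = ∑ i, ∑ j, E x a i j * G j i := by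
      rw [Matrix.trace_mul_comm]
      rfl
    rw [sq, f]
    simp only [Finset.sum_mul]
    simp only [Finset.mul_sum]
    refine Finset.sum_congr rfl fun i _ => Finset.sum_congr rfl fun j _ =>
      Finset.sum_congr rfl fun k _ => Finset.sum_congr rfl fun l _ => ?_
    ring
  simp only [e1]
  rw [e, sq, Matrix.trace, Finset.sum_mul_sum]
  congr 2
  simp only [Matrix.trace, Matrix.diag, Matrix.mul_apply]
  rw [Finset.sum_comm]

/-- The double sum on the right is `d²` times the singlet fraction (up to taking real parts), which
makes the latter readable from prepare-and-measure scores. -/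
theorem sum_trace_apply_mul (h : IsWeightedTwoDesign w E) (N : Matrix n n ℂ →ₗ[ℂ] Matrix n n ℂ) :
    ∑ x, (w x : ℂ) * ∑ a, (N (E x a) * E x a).trace =
      ((N 1).trace + ∑ i, ∑ j, toTensor N i j i j) / (Fintype.card n + 1) := by
  have e := h.sum_bilinear fun i j k l => toTensor N l k i j
  have e1 : ∀ x a, (N (E x a) * E x a).trace =
      ∑ i, ∑ j, ∑ k, ∑ l, toTensor N l k i j * (E x a i j * E x a k l) := fun x a => by
    rw [Matrix.trace]
    simp only [Matrix.diag, Matrix.mul_apply, apply_eq_sum_toTensor, Finset.sum_mul]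
    rw [Finset.sum_comm]
    simp only [← Fintype.sum_prod_type (f := fun p : n × n => ∑ i, ∑ j,
      toTensor N p.2 p.1 i j * E x a i j * E x a p.1 p.2)]
    rw [Finset.sum_comm]
    refine Finset.sum_congr rfl fun i _ => ?_
    rw [Finset.sum_comm]
    refine Finset.sum_congr rfl fun j _ => ?_
    rw [Fintype.sum_prod_type]
    simp only [mul_assoc]
  simp only [e1]
  rw [e]
  congr 2
  rw [Matrix.trace]
  simp only [Matrix.diag, apply_eq_sum_toTensor, Matrix.one_apply, mul_ite, mul_one, mul_zero,
    Finset.sum_ite_eq, Finset.mem_univ, if_true]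
  rw [Finset.sum_comm]

/-- Both `P x ·` and `tr(G E x ·)` have known means over the `d` outcomes, `1/d` and `T/d`. The
means contribute `T/d`; Cauchy–Schwarz bounds the covariance by `T(d-1)/(d√(d+1))`. -/
theorem sum_mul_re_trace_mul_le [Nonempty n] (h : IsWeightedTwoDesign w E)
    (hA : Fintype.card A = Fintype.card n) {G : Matrix n n ℂ} (hG : G.PosSemidef)
    {P : X → A → ℝ} (hP0 : ∀ x a, 0 ≤ P x a) (hP1 : ∀ x, ∑ a, P x a = 1) :
    ∑ x, w x * ∑ a, P x a * (G * E x a).trace.re ≤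
      ((Fintype.card n - 1 + √(Fintype.card n + 1)) / (Fintype.card n * √(Fintype.card n + 1)))
        * G.trace.re := by
  set d : ℝ := (Fintype.card n : ℝ) with hd
  have hd1 : 1 ≤ d := by
    rw [hd, Nat.one_le_cast]
    exact Fintype.card_pos
  have hdA : (Fintype.card A : ℝ) = d := by rw [hA]
  set T : ℝ := G.trace.re with hT
  let g : X → A → ℝ := fun x a => (G * E x a).trace.re
  have hgreal : ∀ x a, (G * E x a).trace = (g x a : ℂ) := fun x a => by
    have h1 : star (G * E x a).trace = (G * E x a).trace := by
      rw [← Matrix.trace_conjTranspose, Matrix.conjTranspose_mul, hG.1.eq,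
        ((h.isMeasurementAssemblage x).1 a).1.eq, Matrix.trace_mul_comm]
    exact (Complex.conj_eq_iff_re.mp h1).symm
  have hT0 : 0 ≤ T := (Complex.nonneg_iff.mp hG.trace_nonneg).1
  have hTreal : G.trace = (T : ℂ) :=
    Complex.ext rfl (Complex.nonneg_iff.mp hG.trace_nonneg).2.symm
  have hg1 : ∀ x, ∑ a, g x a = T := fun x => by
    simp only [g]
    rw [← Complex.re_sum, ← Matrix.trace_sum, ← Finset.mul_sum, (h.isMeasurementAssemblage x).2,
      mul_one]
  -- The design evaluates the second moment exactly; the loss is `tr G² ≤ (tr G)²`, an equality for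
  -- rank-one `G`.
  have hg2 : ∑ x, w x * ∑ a, g x a ^ 2 ≤ 2 * T ^ 2 / (d + 1) := by
    have e := congrArg Complex.re (h.sum_trace_mul_sq G)
    have e1 : ∑ x, (w x : ℂ) * ∑ a, (G * E x a).trace ^ 2 =
        ((∑ x, w x * ∑ a, g x a ^ 2 : ℝ) : ℂ) := by
      simp only [hgreal]
      push_cast
      rfl
    have e2 : (Fintype.card n + 1 : ℂ) = ((d + 1 : ℝ) : ℂ) := by
      rw [hd]
      push_cast
      rfl
    rw [e1, Complex.ofReal_re, e2, Complex.div_ofReal_re, Complex.add_re, hTreal,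
      ← Complex.ofReal_pow, Complex.ofReal_re] at e
    rw [e]
    have := hG.re_trace_mul_self_le
    gcongr
    linarith
  -- From `P² ≤ P`, with equality for deterministic responses.
  have hU : ∑ x, w x * ∑ a, (P x a - 1 / d) ^ 2 ≤ (d - 1) / d := by
    have : ∀ x, ∑ a, (P x a - 1 / d) ^ 2 ≤ (d - 1) / d := fun x => by
      have h1 : ∑ a, P x a ^ 2 ≤ 1 := by
        rw [← hP1 x]
        refine Finset.sum_le_sum fun a _ => ?_
        have h2 : P x a ≤ 1 := by
          rw [← hP1 x]
          exact Finset.single_le_sum (fun b _ => hP0 x b) (Finset.mem_univ a)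
        nlinarith [hP0 x a]
      have h3 : ∑ a, (P x a - 1 / d) ^ 2 =
          ∑ a, P x a ^ 2 - 2 / d * ∑ a, P x a + Fintype.card A * (1 / d) ^ 2 := by
        simp only [sub_sq, Finset.sum_add_distrib, Finset.sum_sub_distrib, Finset.mul_sum,
          Finset.sum_const, Finset.card_univ, nsmul_eq_mul]
        congr 2
        exact Finset.sum_congr rfl fun a _ => by ring
      rw [h3, hP1, hdA]
      have : (d - 1) / d = 1 - 2 / d * 1 + d * (1 / d) ^ 2 := by
        field_simp
        ring
      rw [this]
      linarith
    calc ∑ x, w x * ∑ a, (P x a - 1 / d) ^ 2 ≤ ∑ x, w x * ((d - 1) / d) :=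
          Finset.sum_le_sum fun x _ => mul_le_mul_of_nonneg_left (this x) (h.nonneg x)
      _ = (d - 1) / d := by rw [← Finset.sum_mul, h.sum_eq_one, one_mul]
  have hV : ∑ x, w x * ∑ a, (g x a - T / d) ^ 2 ≤ T ^ 2 * (d - 1) / (d * (d + 1)) := by
    have h3 : ∀ x, ∑ a, (g x a - T / d) ^ 2 = ∑ a, g x a ^ 2 - T ^ 2 / d := fun x => by
      have : ∑ a, (g x a - T / d) ^ 2 =
          ∑ a, g x a ^ 2 - 2 * (T / d) * ∑ a, g x a + Fintype.card A * (T / d) ^ 2 := by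
        simp only [sub_sq, Finset.sum_add_distrib, Finset.sum_sub_distrib, Finset.mul_sum,
          Finset.sum_const, Finset.card_univ, nsmul_eq_mul]
        congr 2
        exact Finset.sum_congr rfl fun a _ => by ring
      rw [this, hg1, hdA]
      field_simp
      ring
    simp only [h3]
    simp only [mul_sub (w _), Finset.sum_sub_distrib]
    rw [← Finset.sum_mul, h.sum_eq_one, one_mul]
    have : T ^ 2 * (d - 1) / (d * (d + 1)) = 2 * T ^ 2 / (d + 1) - T ^ 2 / d := by
      field_simp
      ring
    rw [this]
    linarith
  have hD : ∑ x, w x * ∑ a, (P x a - 1 / d) * (g x a - T / d) =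
      ∑ x, w x * ∑ a, P x a * g x a - T / d := by
    have : ∀ x, ∑ a, (P x a - 1 / d) * (g x a - T / d) = ∑ a, P x a * g x a - T / d := fun x => by
      have : ∑ a, (P x a - 1 / d) * (g x a - T / d) = ∑ a, P x a * g x a
          - T / d * ∑ a, P x a - 1 / d * ∑ a, g x a + Fintype.card A * (1 / d * (T / d)) := by
        simp only [sub_mul, mul_sub, Finset.sum_sub_distrib, ← Finset.mul_sum, ← Finset.sum_mul,
          Finset.sum_const, Finset.card_univ, nsmul_eq_mul]
        ring
      rw [this, hP1, hg1, hdA]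
      field_simp
      ring
    simp only [this]
    simp only [mul_sub (w _), Finset.sum_sub_distrib]
    rw [← Finset.sum_mul, h.sum_eq_one, one_mul]
  have hCS : (∑ x, w x * ∑ a, (P x a - 1 / d) * (g x a - T / d)) ^ 2 ≤
      (∑ x, w x * ∑ a, (P x a - 1 / d) ^ 2) * ∑ x, w x * ∑ a, (g x a - T / d) ^ 2 := by
    have := Finset.sum_mul_sq_le_sq_mul_sq (Finset.univ : Finset (X × A))
      (fun p => √(w p.1) * (P p.1 p.2 - 1 / d)) (fun p => √(w p.1) * (g p.1 p.2 - T / d))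
    have e : ∀ x a, √(w x) * (P x a - 1 / d) * (√(w x) * (g x a - T / d)) =
        w x * ((P x a - 1 / d) * (g x a - T / d)) := fun x a => by
      rw [mul_mul_mul_comm, Real.mul_self_sqrt (h.nonneg x)]
    simpa only [mul_pow, Real.sq_sqrt (h.nonneg _), e, Fintype.sum_prod_type,
      ← Finset.mul_sum] using this
  have hs : 0 < √(d + 1) := Real.sqrt_pos.mpr (by linarith)
  have hss : √(d + 1) ^ 2 = d + 1 := Real.sq_sqrt (by linarith)
  have hfinal : ∑ x, w x * ∑ a, P x a * g x a - T / d ≤ T * (d - 1) / (d * √(d + 1)) := by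
    refine le_of_sq_le_sq ?_ (div_nonneg (mul_nonneg hT0 (by linarith)) (by positivity))
    rw [← hD]
    refine hCS.trans ((mul_le_mul hU hV (Finset.sum_nonneg fun x _ => mul_nonneg (h.nonneg x)
      (Finset.sum_nonneg fun a _ => sq_nonneg _)) (div_nonneg (by linarith) (by linarith))).trans
      (le_of_eq ?_))
    rw [div_pow, mul_pow d, hss]
    field_simp
  have e : (d - 1 + √(d + 1)) / (d * √(d + 1)) * T = T * (d - 1) / (d * √(d + 1)) + T / d := by
    field_simp
  rw [e]
  linarith

end IsWeightedTwoDesign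

end Design

/-! ### Construction of a weighted 2-design. -/

section Existence

variable {n : Type}

/-- The measurements used to detect incompatibility preservation: the standard basis, and the
columns of a complex Hadamard matrix `χ` twisted by every diagonal phase given by third roots of
unity. -/
noncomputable def phasedBases [Fintype n] [DecidableEq n] (χ : n → n → ℂ) :
    Option (n → ZMod 3) → n → Matrix n n ℂ
  | none, a => Matrix.single a a 1
  | some z, a => ((Fintype.card n : ℝ)⁻¹) • Matrix.vecMulVec (fun i => cubicPhase z i * χ a i)
      (star fun i => cubicPhase z i * χ a i)

/-- The weights making `phasedBases` a weighted 2-design. -/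
noncomputable def phasedBasesWeight (n : Type) [Fintype n] : Option (n → ZMod 3) → ℝ
  | none => 1 / (Fintype.card n + 1)
  | some _ => Fintype.card n / ((Fintype.card n + 1) * 3 ^ Fintype.card n)

variable [Fintype n] [DecidableEq n]

theorem phasedBases_some_apply (χ : n → n → ℂ) (z : n → ZMod 3) (a i j : n) :
    phasedBases χ (some z) a i j = (Fintype.card n : ℂ)⁻¹ *
      (cubicPhase z i * star (cubicPhase z j) * (χ a i * star (χ a j))) := by
  simp only [phasedBases, Matrix.smul_apply, Matrix.vecMulVec_apply, Pi.star_apply, star_mul',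
    Complex.real_smul]
  push_cast
  ring

/-- The phased bases contribute `1/(d+1)` whenever at least one of the two index pairings holds.
When both hold, all indices agree and the target is `2/(d+1)`; the standard basis supplies exactly
the missing term. -/
theorem isWeightedTwoDesign_phasedBases [Nonempty n] {χ : n → n → ℂ}
    (h1 : ∀ a i, χ a i * star (χ a i) = 1)
    (h2 : ∀ i j, ∑ a, χ a i * star (χ a j) = if i = j then (Fintype.card n : ℂ) else 0) :
    IsWeightedTwoDesign (phasedBasesWeight n) (phasedBases χ) := by
  have hn : (Fintype.card n : ℂ) ≠ 0 := by
    exact_mod_cast Fintype.card_ne_zero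
  have hn1 : (Fintype.card n + 1 : ℂ) ≠ 0 := by exact_mod_cast (Fintype.card n).succ_ne_zero
  refine ⟨?_, ?_, ?_, ?_, ?_⟩
  · rintro (_ | z) <;> simp only [phasedBasesWeight] <;> positivity
  · rw [Fintype.sum_option]
    simp only [phasedBasesWeight, Finset.sum_const, Finset.card_univ, Fintype.card_fun, ZMod.card,
      nsmul_eq_mul, Nat.cast_pow, Nat.cast_ofNat]
    field_simp
    ring
  · rintro (_ | z)
    · refine ⟨fun a => ?_, ?_⟩
      · simp only [phasedBases, ← Matrix.diagonal_single]
        refine Matrix.PosSemidef.diagonal fun i => ?_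
        rw [Pi.single_apply]
        split_ifs <;> simp
      · ext i j
        simp [phasedBases, Matrix.sum_apply, Matrix.single_apply, Matrix.one_apply, ite_and]
    · refine ⟨fun a => (Matrix.posSemidef_vecMulVec_self_star _).smul (by positivity), ?_⟩
      ext i j
      rw [Matrix.sum_apply]
      simp only [phasedBases_some_apply]
      rw [← Finset.mul_sum, ← Finset.mul_sum, h2, Matrix.one_apply]
      split_ifs with hij
      · rw [hij, cubicPhase_mul_star_self, one_mul, inv_mul_cancel₀ hn]
      · simp
  · rintro (_ | z) a
    · exact Matrix.trace_single_eq_same a 1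
    · simp only [Matrix.trace, Matrix.diag, phasedBases_some_apply, cubicPhase_mul_star_self, h1,
        mul_one, Finset.sum_const, Finset.card_univ, nsmul_eq_mul]
      exact mul_inv_cancel₀ hn
  · intro i j k l
    rw [Fintype.sum_option]
    have e0 : ∑ a, phasedBases χ none a i j * phasedBases χ none a k l =
        if i = j ∧ i = k ∧ i = l then 1 else 0 := by
      simp only [phasedBases, Matrix.single_apply]
      rw [Finset.sum_eq_single i]
      · simp only [true_and]
        split_ifs <;> grind
      · intro b _ hb
        simp [hb]
      · simp
    have e1 : ∑ z, ((phasedBasesWeight n (some z) : ℝ) : ℂ) *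
        ∑ a, phasedBases χ (some z) a i j * phasedBases χ (some z) a k l =
        (if (i = j ∧ k = l) ∨ (i = l ∧ k = j) then 1 else 0) / (Fintype.card n + 1) := by
      have e2 : ∀ z, ((phasedBasesWeight n (some z) : ℝ) : ℂ) *
          ∑ a, phasedBases χ (some z) a i j * phasedBases χ (some z) a k l =
          (cubicPhase z i * star (cubicPhase z j) * (cubicPhase z k * star (cubicPhase z l))) *
          ((∑ a, χ a i * star (χ a j) * (χ a k * star (χ a l))) /
            ((Fintype.card n + 1) * 3 ^ Fintype.card n * Fintype.card n)) := fun z => by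
        simp only [phasedBases_some_apply, phasedBasesWeight, Finset.sum_div, Finset.mul_sum]
        refine Finset.sum_congr rfl fun a _ => ?_
        push_cast
        field_simp
      simp only [e2]
      rw [← Finset.sum_mul, sum_cubicPhase_four]
      split_ifs with h
      · have e3 : ∀ a, χ a i * star (χ a j) * (χ a k * star (χ a l)) = 1 := fun a => by
          rcases h with ⟨rfl, rfl⟩ | ⟨rfl, rfl⟩
          · rw [h1, h1, one_mul]
          · rw [mul_mul_mul_comm, mul_comm (star _), mul_mul_mul_comm, h1, h1, one_mul]
        simp only [e3, Finset.sum_const, Finset.card_univ, nsmul_eq_mul, mul_one]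
        field_simp
      · simp
    rw [e0, e1]
    simp only [phasedBasesWeight]
    push_cast
    rw [one_div, inv_mul_eq_div, ← add_div]
    congr 1
    by_cases ha : i = j ∧ k = l <;> by_cases hb : i = l ∧ k = j
    · rw [if_pos ⟨ha.1, ha.1.trans hb.2.symm, hb.1⟩, if_pos (Or.inl ha), if_pos ha, if_pos hb]
    all_goals
      have : ¬ (i = j ∧ i = k ∧ i = l) := by
        rintro ⟨rfl, rfl, rfl⟩
        simp at ha hb
      rw [if_neg this, zero_add]
    · rw [if_pos (Or.inl ha), if_pos ha, if_neg hb, add_zero]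
    · rw [if_pos (Or.inr hb), if_neg ha, if_pos hb, zero_add]
    · rw [if_neg (not_or.mpr ⟨ha, hb⟩), if_neg ha, if_neg hb, add_zero]

theorem exists_isWeightedTwoDesign (d : ℕ) [NeZero d] :
    ∃ (w : Option (Fin d → ZMod 3) → ℝ) (E : Option (Fin d → ZMod 3) → Fin d →
      Matrix (Fin d) (Fin d) ℂ), IsWeightedTwoDesign w E := by
  let e : Fin d ≃+* ZMod d := ZMod.finEquiv d
  -- The Fourier matrix of `ZMod d` is the complex Hadamard matrix used.
  let χ : Fin d → Fin d → ℂ := fun a i => ZMod.stdAddChar (e a * e i)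
  have hχ : ∀ a i j, χ a i * star (χ a j) = ZMod.stdAddChar (e a * (e i - e j)) := fun a i j => by
    simp only [χ]
    rw [Complex.star_def, ← AddChar.map_neg_eq_conj, ← AddChar.map_add_eq_mul, mul_sub,
      sub_eq_add_neg]
  refine ⟨_, _, isWeightedTwoDesign_phasedBases (χ := χ) (fun a i => ?_) fun i j => ?_⟩
  · rw [hχ, sub_self, mul_zero, AddChar.map_zero_eq_one]
  · simp only [hχ]
    rw [Fintype.sum_equiv e.toEquiv (fun a => ZMod.stdAddChar (e a * (e i - e j)))
        (fun x => ZMod.stdAddChar (x * (e i - e j))) fun _ => rfl,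
      AddChar.sum_mulShift _ (ZMod.isPrimitive_stdAddChar d)]
    simp [sub_eq_zero]

end Existence

/-! ### The singlet fraction and its bound on annihilating channels. -/

section SingletFraction

variable {n : Type} [Fintype n] [DecidableEq n]

theorem singletFraction_eq (N : Matrix n n ℂ →ₗ[ℂ] Matrix n n ℂ) :
    singletFraction N = (∑ i, ∑ j, toTensor N i j i j).re / (Fintype.card n : ℝ) ^ 2 := by
  set s : ℝ := 1 / √(Fintype.card n : ℝ) with hs
  have hs4 : s ^ 4 = 1 / (Fintype.card n : ℝ) ^ 2 := by
    rw [hs, div_pow, one_pow, show 4 = 2 * 2 from rfl, pow_mul, Real.sq_sqrt (Nat.cast_nonneg _)]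
  have hblock : ∀ k l : n, (Matrix.of fun i j =>
      Matrix.vecMulVec (maxEntangled n) (star (maxEntangled n)) (i, k) (j, l)) =
      ((s : ℂ) ^ 2) • Matrix.single k l (1 : ℂ) := by
    intro k l
    ext i j
    simp only [Matrix.of_apply, Matrix.vecMulVec_apply, maxEntangled, Pi.star_apply,
      Matrix.smul_apply, Matrix.single_apply, ← hs]
    simp only [eq_comm (a := k), eq_comm (a := l)]
    by_cases h1 : i = k <;> by_cases h2 : j = l <;> simp [h1, h2, sq]
  have h : star (maxEntangled n) ⬝ᵥ (applyLocally N
      (Matrix.vecMulVec (maxEntangled n) (star (maxEntangled n))) *ᵥ maxEntangled n) =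
      ((s ^ 4 : ℝ) : ℂ) * ∑ i, ∑ j, toTensor N i j i j := by
    simp only [dotProduct, Matrix.mulVec, applyLocally, Matrix.of_apply, hblock, map_smul,
      Matrix.smul_apply, Fintype.sum_prod_type, Finset.mul_sum]
    simp only [maxEntangled, Pi.star_apply, ← hs]
    refine Finset.sum_congr rfl fun i _ => ?_
    rw [Finset.sum_eq_single i]
    · refine Finset.sum_congr rfl fun j _ => ?_
      rw [Finset.sum_eq_single j]
      · simp [toTensor]
        ring
      · intro b _ hb
        simp [Ne.symm hb]
      · simp
    · intro b _ hb
      simp [Ne.symm hb]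
    · simp
  rw [singletFraction, h, Complex.re_ofReal_mul, hs4]
  ring

theorem singletFraction_nonneg {N : Matrix n n ℂ →ₗ[ℂ] Matrix n n ℂ}
    (hN : IsCompletelyPositive N) : 0 ≤ singletFraction N :=
  (Complex.nonneg_iff.mp ((hN.posSemidef_applyLocally
    (Matrix.posSemidef_vecMulVec_self_star (maxEntangled n))).dotProduct_mulVec_nonneg _)).1

theorem singletFraction_add (N L : Matrix n n ℂ →ₗ[ℂ] Matrix n n ℂ) :
    singletFraction (N + L) = singletFraction N + singletFraction L := by
  simp only [singletFraction, applyLocally_add, Matrix.add_mulVec, dotProduct_add, Complex.add_re]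

theorem singletFraction_smul (c : ℝ) (N : Matrix n n ℂ →ₗ[ℂ] Matrix n n ℂ) :
    singletFraction (c • N) = c * singletFraction N := by
  simp only [singletFraction, applyLocally_smul, Matrix.smul_mulVec, dotProduct_smul,
    Complex.smul_re, smul_eq_mul]

theorem singletFraction_le_of_mem_IA {X A : Type} [Fintype X] [Fintype A] [Nonempty n]
    {w : X → ℝ} {E : X → A → Matrix n n ℂ} (h : IsWeightedTwoDesign w E)
    (hA : Fintype.card A = Fintype.card n) {N : Matrix n n ℂ →ₗ[ℂ] Matrix n n ℂ} (hN : N ∈ IA n) :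
    singletFraction N ≤
      (Fintype.card n - 1 + √(Fintype.card n + 1)) / (Fintype.card n * √(Fintype.card n + 1)) := by
  obtain ⟨M, ⟨-, L, _, G, P, hG, hP0, hP1, hM⟩, hMN⟩ := hN.2 X A E h.isMeasurementAssemblage
  have e := congrArg Complex.re (h.sum_trace_apply_mul N)
  have hF := singletFraction_eq N
  set d : ℝ := (Fintype.card n : ℝ) with hd
  set q : ℝ := (d - 1 + √(d + 1)) / (d * √(d + 1)) with hq
  have hd1 : 1 ≤ d := by
    rw [hd, Nat.one_le_cast]
    exact Fintype.card_pos
  have hF' : (∑ i, ∑ j, toTensor N i j i j).re = d ^ 2 * singletFraction N := by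
    rw [hF]
    field_simp
  have e2 : (Fintype.card n + 1 : ℂ) = ((d + 1 : ℝ) : ℂ) := by
    rw [hd]
    push_cast
    rfl
  rw [e2, Complex.div_ofReal_re, Complex.add_re, hF', hN.1.2, Matrix.trace_one,
    Complex.natCast_re, ← hd] at e
  have e3 : (∑ x, (w x : ℂ) * ∑ a, (N (E x a) * E x a).trace).re =
      ∑ l, ∑ x, w x * ∑ a, P x l a * (G l * E x a).trace.re := by
    have : ∀ x a, (N (E x a) * E x a).trace.re = ∑ l, P x l a * (G l * E x a).trace.re := by
      intro x a
      -- Trace-one effects double as input states.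
      rw [hMN (E x a) ⟨(h.isMeasurementAssemblage x).1 a, h.trace_eq_one x a⟩, hM,
        Matrix.trace_mul_comm, Finset.sum_mul, Matrix.trace_sum, Complex.re_sum]
      refine Finset.sum_congr rfl fun l _ => ?_
      rw [Matrix.smul_mul, Matrix.trace_smul, Complex.smul_re, smul_eq_mul]
    simp only [Complex.re_sum, Complex.re_ofReal_mul, this]
    rw [Finset.sum_comm]
    refine Finset.sum_congr rfl fun x _ => ?_
    rw [← Finset.mul_sum, Finset.sum_comm]
  have e4 : ∑ l, ∑ x, w x * ∑ a, P x l a * (G l * E x a).trace.re ≤ q * d := by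
    calc _ ≤ ∑ l, q * (G l).trace.re := Finset.sum_le_sum fun l _ =>
          h.sum_mul_re_trace_mul_le hA (hG.1 l) (fun x a => hP0 x l a) (fun x => hP1 x l)
      _ = q * d := by
          rw [← Finset.mul_sum, ← Complex.re_sum, ← Matrix.trace_sum, hG.2, Matrix.trace_one,
            Complex.natCast_re]
  rw [← e3, e, div_le_iff₀ (by linarith)] at e4
  -- The score bound reads `d + d²F ≤ q d (d + 1)`; `q ≤ 1` discards the remainder `d(q - 1)`.
  have hq1 : q ≤ 1 := by
    have hs : 1 ≤ √(d + 1) := Real.one_le_sqrt.mpr (by linarith)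
    rw [hq, div_le_one (by positivity)]
    nlinarith
  have : d ^ 2 * singletFraction N ≤ d ^ 2 * q := by nlinarith
  exact le_of_mul_le_mul_left this (by positivity)

end SingletFraction

/-! ### Asymptotics of the threshold and final assembly. -/

theorem isEquivalent_threshold :
    Asymptotics.IsEquivalent Filter.atTop
      (fun d : ℕ => ((d : ℝ) - 1 + √((d : ℝ) + 1)) / ((d : ℝ) * √((d : ℝ) + 1)))
      (fun d : ℕ => 1 / √(d : ℝ)) := by
  refine Asymptotics.isEquivalent_of_tendsto_one ?_
  have h0 : Filter.Tendsto (fun d : ℕ => (1 : ℝ) / d) Filter.atTop (nhds 0) :=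
    tendsto_one_div_atTop_nhds_zero_nat
  -- This is the threshold times `√d`, rewritten in terms of `1/d`.
  have h1 : Filter.Tendsto (fun d : ℕ => (1 - (1 : ℝ) / d) / √(1 + 1 / d) + √((1 : ℝ) / d))
      Filter.atTop (nhds ((1 - 0) / √(1 + 0) + √0)) :=
    ((tendsto_const_nhds.sub h0).div (tendsto_const_nhds.add h0).sqrt (by simp)).add h0.sqrt
  simp only [sub_zero, add_zero, Real.sqrt_one, div_one, Real.sqrt_zero] at h1
  refine h1.congr' ?_
  filter_upwards [Filter.eventually_gt_atTop 0] with d hd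
  have hd' : (0 : ℝ) < d := by exact_mod_cast hd
  have h2 : (1 : ℝ) + 1 / d = (d + 1) / d := by field_simp
  have hs : √(d : ℝ) ^ 2 = d := Real.sq_sqrt hd'.le
  rw [h2, Real.sqrt_div (by positivity), Real.sqrt_div (by positivity), Real.sqrt_one,
    Pi.div_apply]
  have : 0 < √(d : ℝ) := Real.sqrt_pos.mpr hd'
  have : 0 < √((d : ℝ) + 1) := Real.sqrt_pos.mpr (by positivity)
  field_simp
  rw [hs]
  ring

theorem mainTheorem6 :
    (∀ d : ℕ, IsPrimePow d →
      ∀ N : Matrix (Fin d) (Fin d) ℂ →ₗ[ℂ] Matrix (Fin d) (Fin d) ℂ, IsChannel N →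
        IsLeast (annihilatingWeights N) (robustness N) ∧
        singletFraction N * ((d : ℝ) * √((d : ℝ) + 1)) / ((d : ℝ) - 1 + √((d : ℝ) + 1))
          ≤ 1 + robustness N ∧
        (((d : ℝ) - 1 + √((d : ℝ) + 1)) / ((d : ℝ) * √((d : ℝ) + 1)) < singletFraction N →
          HasIncompatibilityPreservability N)) ∧
    Asymptotics.IsEquivalent Filter.atTop
      (fun d : ℕ => ((d : ℝ) - 1 + √((d : ℝ) + 1)) / ((d : ℝ) * √((d : ℝ) + 1)))
      (fun d : ℕ => 1 / √(d : ℝ)) := by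
  refine ⟨fun d hd N hN => ?_, isEquivalent_threshold⟩
  have : NeZero d := ⟨hd.ne_zero⟩
  obtain ⟨w, E, hE⟩ := exists_isWeightedTwoDesign d
  have hIA : ∀ L ∈ IA (Fin d), singletFraction L ≤
      ((d : ℝ) - 1 + √((d : ℝ) + 1)) / ((d : ℝ) * √((d : ℝ) + 1)) := fun L hL => by
    simpa only [Fintype.card_fin] using singletFraction_le_of_mem_IA hE rfl hL
  have hleast := isLeast_robustness hN
  refine ⟨hleast, ?_, fun hlt => ⟨hN, fun hmem => (hIA N hmem).not_gt hlt⟩⟩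
  obtain ⟨ht, W, hW, hmem⟩ := hleast.1
  have hd1 : (1 : ℝ) ≤ d := Nat.one_le_cast.mpr (Nat.pos_of_ne_zero hd.ne_zero)
  have hs : 0 < √((d : ℝ) + 1) := Real.sqrt_pos.mpr (by linarith)
  have hF := hIA _ hmem
  rw [singletFraction_smul, singletFraction_add, singletFraction_smul,
    inv_mul_le_iff₀ (by linarith)] at hF
  -- The noise channel's nonnegative contribution to the singlet fraction is dropped.
  have hle : singletFraction N ≤ (1 + robustness N) *
      (((d : ℝ) - 1 + √((d : ℝ) + 1)) / ((d : ℝ) * √((d : ℝ) + 1))) :=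
    (le_add_of_nonneg_right (mul_nonneg ht (singletFraction_nonneg hW.1))).trans hF
  rw [mul_div_assoc', le_div_iff₀ (by positivity)] at hle
  rwa [div_le_iff₀ (by linarith)]
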